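/- Let $n,d\ge 1$ be integers. For $x\in\mathbb{C}$ and $j\in\mathbb{Z}$ let $\binom{x}{j}=\frac{x(x-1)\cdots(x-j+1)}{j!}$ if $j\ge 0$ and $\binom{x}{j}=0$ if $j<0$. A monotone triangle of size $n$ is a triangular array of integers $(a_{i,j})_{1\le j\le i\le n}$ with $a_{i,j}<a_{i,j+1}$ and $a_{i+1,j}\le a_{i,j}\le a_{i+1,j+1}$ whenever these entries are defined. Let $\alpha(n;k_1,\ldots,k_n)$ be the polynomial in $k_1,\dots,k_n$ whose value at all integers $k_1<k_2<\cdots<k_n$ is the number of monotone triangles with bottom row $(k_1,\ldots,k_n)$; explicitly, $$\alpha(n;k_1,\ldots,k_n)=\prod_{1\le p<q\le n}\left(\operatorname{id}+E_{k_p}E_{k_q}-E_{k_p}\right)\det_{1\le i,j\le n}\binom{k_i}{j-1},\qquad E_xf(x):=f(x+1).$$ Let $\Delta_x f(x):=f(x+1)-f(x)$. For $z\in\mathbb{Z}$ define the right inverse difference operator ${}^{z}\Delta_x^{-1}p(x):=-\sum_{x'=x}^{z}p(x')$ for integers $x$, where for $b<a$ one sets $\sum_{i=a}^{b}f(i):=-\sum_{i=b+1}^{a-1}f(i)$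 (so the sum is $0$ if $b=a-1$). For $i<0$ and $\mathbf{z}_i=(z_i,z_{i+1},\ldots,z_{-1})\in\mathbb{Z}^{-i}$ let $${}^{\mathbf{z}_i}\Delta_x^{i}:={}^{z_i}\Delta_x^{-1}\;{}^{z_{i+1}}\Delta_x^{-1}\cdots{}^{z_{-1}}\Delta_x^{-1}.$$ Let $\mathbf{x}=(x_j)_{j<0}$ be any sequence of integers, put $\mathbf{x}_i=(x_i,\ldots,x_{-1})$ for $i<0$, and define $$C^{(d)}_{n,i}:=\begin{cases}(-1)^i\,\Delta_{k_1}^i\,\alpha(n;k_1,2d,3d,\ldots,nd)\big|_{k_1=d+1}, & i=0,\ldots,n-1,\\ (-1)^i\;{}^{\mathbf{x}_i}\Delta_{k_1}^i\,\alpha(n;k_1,2d,3d,\ldots,nd)\big|_{k_1=d+1}, & i=-n,\ldots,-1.\end{cases}$$ Let $z_j:=(n+2)(d+1)-x_j-j-4$ for $j<0$, $\mathbf{z}_i=(z_i,\ldots,z_{-1})$, and define $$D^{(d)}_{n,i}:=\begin{cases}(-1)^i\,\Delta_{k_1}^i\,\alpha(n;k_1,2d,3d,\ldots,nd)\big|_{k_1=d+1},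 & i=0,\ldots,n-1,\\ (-1)^i\;{}^{\mathbf{z}_i}\Delta_{k_1}^i\,\alpha(n;k_1,2d,3d,\ldots,nd)\big|_{k_1=d+1}, & i=-n,\ldots,-1.\end{cases}$$ Then, for all $i=-n,\ldots,n-1$, $$C^{(d)}_{n,i}=\sum_{j=i}^{n-1}\binom{n(d+1)-i-2}{j-i}(-1)^{j+n+1}D^{(d)}_{n,j}.$$ -/

import Mathlib

open scoped fwdDiff

/-- A polynomial in the shift operators, acting on functions of `n` integer variables:
the variable `X p` acts as the shift operator `E_{k_p}`, i.e.
`(E_{k_p} f)(k_1, …, k_n) = f (k_1, …, k_p + 1, …, k_n)`, and products of polynomials act as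
compositions of operators. -/
noncomputable def shiftHom (n : ℕ) :
    MvPolynomial (Fin n) ℤ →ₐ[ℤ] Module.End ℤ ((Fin n → ℤ) → ℤ) :=
  AddMonoidAlgebra.lift ℤ (Module.End ℤ ((Fin n → ℤ) → ℤ)) (Fin n →₀ ℕ)
    { toFun := fun m =>
        LinearMap.funLeft ℤ ℤ (fun (k : Fin n → ℤ) i => k i + (Multiplicative.toAdd m i : ℕ))
      map_one' := by
        ext f k
        simp [LinearMap.funLeft_apply]
      map_mul' := by
        intro a b
        ext f k
        simp only [LinearMap.funLeft_apply, Module.End.mul_apply, toAdd_mul, Finsupp.add_apply,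
          Nat.cast_add, add_assoc] }

theorem shiftHom_X {n : ℕ} (p : Fin n) (f : (Fin n → ℤ) → ℤ) (k : Fin n → ℤ) :
    shiftHom n (MvPolynomial.X p) f k = f (k + Pi.single p 1) := by
  have : shiftHom n (MvPolynomial.X p) =
      LinearMap.funLeft ℤ ℤ (fun (k : Fin n → ℤ) i => k i + (Finsupp.single p 1 i : ℕ)) := by
    simp [shiftHom, MvPolynomial.X, MvPolynomial.monomial]
  rw [this, LinearMap.funLeft_apply]
  congr 1
  ext i
  by_cases h : i = p
  · subst h; simp
  · simp [h]

/-- The operator polynomial `∏_{1 ≤ p < q ≤ n} (id + E_{k_p} E_{k_q} - E_{k_p})`. -/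
noncomputable def alphaOp (n : ℕ) : MvPolynomial (Fin n) ℤ :=
  ∏ p : Fin n, ∏ q ∈ Finset.Ioi p,
    (1 + MvPolynomial.X p * MvPolynomial.X q - MvPolynomial.X p)

/-- The polynomial `α(n; k_1, …, k_n)` as a function on `ℤⁿ`:
`∏_{p < q} (id + E_{k_p} E_{k_q} - E_{k_p})` applied to `det (binom (k_i) (j-1))_{1 ≤ i, j ≤ n}`. It is the polynomial whose value at strictly
increasing integers is the number of monotone triangles with bottom row `(k_1, …, k_n)`: this is
proved in `isPolyFun_alpha` and `alpha_eq_ncard` below. -/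
noncomputable def alpha (n : ℕ) : (Fin n → ℤ) → ℤ :=
  shiftHom n (alphaOp n)
    (fun k => Matrix.det (Matrix.of fun i j : Fin n => Ring.choose (k i) (j : ℕ)))

/-- Monotone triangles with `n` rows: the row with index `i` has `i` entries (so the row with
index `0` is empty), rows are strictly increasing, and
`a_{i+1,j} ≤ a_{i,j} ≤ a_{i+1,j+1}`. -/
structure IsMonotoneTriangle {n : ℕ} (a : (i : Fin (n + 1)) → Fin i → ℤ) : Prop where
  strictMono : ∀ i, StrictMono (a i)
  interlace : ∀ (i : Fin n) (j : Fin i),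
    a i.succ j.castSucc ≤ a i.castSucc j ∧ a i.castSucc j ≤ a i.succ j.succ

/-- The monotone triangles with `n` rows and bottom row `k`. -/
def monotoneTriangles (n : ℕ) (k : Fin n → ℤ) : Set ((i : Fin (n + 1)) → Fin i → ℤ) :=
  {a | IsMonotoneTriangle a ∧ a (Fin.last n) = k}

/-- The binomial coefficient `binom x j` for integers `x` and `j`; it is `0` for `j < 0` and
`x (x-1) ⋯ (x-j+1) / j!` for `j ≥ 0`. -/
def binom (x j : ℤ) : ℤ := if 0 ≤ j then Ring.choose x j.toNat else 0

/-- The extended summation `∑_{i=a}^{b} f i`, which for `b < a` is `- ∑_{i=b+1}^{a-1} f i`. -/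
noncomputable def extSum (a b : ℤ) (f : ℤ → ℤ) : ℤ :=
  if a ≤ b then ∑ i ∈ Finset.Icc a b, f i else -∑ i ∈ Finset.Icc (b + 1) (a - 1), f i

/-- The right inverse difference operator `^zΔ_x^{-1}`. -/
noncomputable def invDelta (z : ℤ) (p : ℤ → ℤ) : ℤ → ℤ := fun x => -extSum x z p

/-- `invDeltaPow z m` is `^{𝐳}Δ_x^{-m} = ^{z_{-m}}Δ_x^{-1} ^{z_{-m+1}}Δ_x^{-1} ⋯ ^{z_{-1}}Δ_x^{-1}`,
for a sequence `z`, of which only the entries with negative index are used. -/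
noncomputable def invDeltaPow (z : ℤ → ℤ) : ℕ → (ℤ → ℤ) → (ℤ → ℤ)
  | 0, p => p
  | m + 1, p => invDelta (z (-((m : ℤ) + 1))) (invDeltaPow z m p)

/-- `Δ_x^i` for `i ≥ 0`, and `^{𝐳_i}Δ_x^i` with `𝐳_i = (z_i, …, z_{-1})` for `i < 0`. -/
noncomputable def deltaPow (z : ℤ → ℤ) (i : ℤ) (p : ℤ → ℤ) : ℤ → ℤ :=
  if 0 ≤ i then (Δ_[(1 : ℤ)])^[i.toNat] p else invDeltaPow z (-i).toNat p

/-- `k₁ ↦ α(n; k₁, 2d, 3d, …, nd)`. -/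
noncomputable def alphaRow (n d : ℕ) (k₁ : ℤ) : ℤ :=
  alpha n (fun j : Fin n => if (j : ℕ) = 0 then k₁ else ((j : ℤ) + 1) * d)

/-- The numbers `C_{n,i}^{(d)}` (for `-n ≤ i ≤ n-1`), with the sequence `𝐱 = (x_j)_{j<0}`. -/
noncomputable def numC (n d : ℕ) (x : ℤ → ℤ) (i : ℤ) : ℤ :=
  (i.negOnePow : ℤ) * deltaPow x i (alphaRow n d) ((d : ℤ) + 1)

/-- The shifted sequence `z_j = (n+2)(d+1) - x_j - j - 4`. -/
def zSeq (n d : ℕ) (x : ℤ → ℤ) : ℤ → ℤ := fun j => ((n : ℤ) + 2) * (d + 1) - x j - j - 4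

/-- The numbers `D_{n,i}^{(d)}` (for `-n ≤ i ≤ n-1`), defined like `C_{n,i}^{(d)}` but with the
sequence `𝐳` in place of `𝐱`. -/
noncomputable def numD (n d : ℕ) (x : ℤ → ℤ) (i : ℤ) : ℤ :=
  (i.negOnePow : ℤ) * deltaPow (zSeq n d x) i (alphaRow n d) ((d : ℤ) + 1)

/- The remaining facts prove that `alpha n` is a polynomial and that it counts monotone triangles.
No definition used in the statement depends on them. -/

open MvPolynomial in
theorem shiftHom_transfer {m n : ℕ} (g : (Fin n → ℤ) → (Fin m → ℤ))
    (φ : MvPolynomial (Fin n) ℤ →ₐ[ℤ] MvPolynomial (Fin m) ℤ)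
    (h : ∀ p f k, shiftHom n (X p) (f ∘ g) k = shiftHom m (φ (X p)) f (g k))
    (P : MvPolynomial (Fin n) ℤ) (f : (Fin m → ℤ) → ℤ) (k : Fin n → ℤ) :
    shiftHom n P (f ∘ g) k = shiftHom m (φ P) f (g k) := by
  induction P using MvPolynomial.induction_on generalizing f k with
  | C a =>
    rw [← MvPolynomial.algebraMap_eq, AlgHom.commutes, AlgHom.commutes, AlgHom.commutes]
    simp
  | add p q hp hq => simp [hp, hq]
  | mul_X P p ih =>
    rw [map_mul, map_mul, map_mul, Module.End.mul_apply, Module.End.mul_apply]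
    have : shiftHom n (X p) (f ∘ g) = (shiftHom m (φ (X p)) f) ∘ g := by
      funext k; exact h p f k
    rw [this, ih]

/-- Sequences `l` with `k_i ≤ l_i ≤ k_{i+1}` and `l` strictly increasing. -/
noncomputable def interlacing {n : ℕ} (k : Fin (n + 1) → ℤ) : Finset (Fin n → ℤ) :=
  open Classical in
  (Fintype.piFinset fun i : Fin n => Finset.Icc (k i.castSucc) (k i.succ)).filter StrictMono

theorem mem_interlacing {n : ℕ} (k : Fin (n + 1) → ℤ) (l : Fin n → ℤ) :
    l ∈ interlacing k ↔ (∀ i, k i.castSucc ≤ l i ∧ l i ≤ k i.succ) ∧ StrictMono l := by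
  simp [interlacing]

theorem mem_interlacing_cons {n : ℕ} (k : Fin (n + 2) → ℤ) (hk : k 0 ≤ k 1) (a : ℤ)
    (l : Fin n → ℤ) :
    (Fin.cons a l : Fin (n + 1) → ℤ) ∈ interlacing k ↔
      (a ∈ Finset.Ico (k 0) (k 1) ∧ l ∈ interlacing (Fin.tail k)) ∨
      (a = k 1 ∧ l ∈ interlacing (Function.update (Fin.tail k) 0 (k 1 + 1))) := by
  simp only [mem_interlacing]
  cases n with
  | zero =>
    have h1 : StrictMono (Fin.cons a l : Fin 1 → ℤ) := Subsingleton.strictMono (α := Fin 1) _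
    have h2 : StrictMono l := Subsingleton.strictMono _
    simp [h1, h2]
    omega
  | succ n =>
    simp [Fin.strictMono_iff_lt_succ, Fin.forall_fin_succ (n := n + 1),
      Fin.forall_fin_succ (n := n), Fin.tail, Fin.succ_ne_zero]
    grind

theorem sum_interlacing_succ {n : ℕ} (k : Fin (n + 2) → ℤ) (hk : k 0 ≤ k 1)
    (G : (Fin (n + 1) → ℤ) → ℤ) :
    ∑ l ∈ interlacing k, G l =
      ∑ a ∈ Finset.Ico (k 0) (k 1), ∑ l ∈ interlacing (Fin.tail k), G (Fin.cons a l) +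
      ∑ l ∈ interlacing (Function.update (Fin.tail k) 0 (k 1 + 1)), G (Fin.cons (k 1) l) := by
  classical
  have h : interlacing k =
      ((Finset.Ico (k 0) (k 1) ×ˢ interlacing (Fin.tail k)).image
        fun p => (Fin.cons p.1 p.2 : Fin (n + 1) → ℤ)) ∪
      (interlacing (Function.update (Fin.tail k) 0 (k 1 + 1))).image
        fun l => (Fin.cons (k 1) l : Fin (n + 1) → ℤ) := by
    ext l
    rw [← Fin.cons_self_tail l, mem_interlacing_cons k hk]
    simp only [Finset.mem_union, Finset.mem_image, Finset.mem_product, Prod.exists, Fin.cons_inj]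
    constructor
    · rintro (⟨h1, h2⟩ | ⟨h1, h2⟩)
      · exact Or.inl ⟨_, _, ⟨h1, h2⟩, rfl, rfl⟩
      · exact Or.inr ⟨_, h2, h1.symm, rfl⟩
    · rintro (⟨a, b, ⟨h1, h2⟩, rfl, rfl⟩ | ⟨a, h2, h1, rfl⟩)
      · exact Or.inl ⟨h1, h2⟩
      · exact Or.inr ⟨h1.symm, h2⟩
  rw [h, Finset.sum_union, Finset.sum_image, Finset.sum_image, Finset.sum_product]
  · intro a _ b _ hab
    exact (Fin.cons_inj.1 hab).2
  · intro a _ b _ hab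
    exact Prod.ext (Fin.cons_inj.1 hab).1 (Fin.cons_inj.1 hab).2
  · rw [Finset.disjoint_left]
    intro l h1 h2
    simp only [Finset.mem_image, Finset.mem_product, Prod.exists, Finset.mem_Ico] at h1 h2
    obtain ⟨a, b, ⟨h3, h4⟩, rfl⟩ := h1
    obtain ⟨c, h5, h6⟩ := h2
    have := (Fin.cons_inj.1 h6).1
    omega

theorem sum_Ico_sub (f : ℤ → ℤ) (a b : ℤ) (h : a ≤ b) :
    ∑ x ∈ Finset.Ico a b, (f (x + 1) - f x) = f b - f a := by
  induction b, h using Int.leInduction with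
  | base => simp
  | succ b hb ih =>
    have : Finset.Ico a (b + 1) = insert b (Finset.Ico a b) := by
      ext x; simp; omega
    rw [this, Finset.sum_insert (by simp), ih]; ring

/-- The operator polynomial `∏_i Δ_{k_i}`. -/
noncomputable def diffOp (n : ℕ) : MvPolynomial (Fin n) ℤ :=
  ∏ i : Fin n, (MvPolynomial.X i - 1)

open MvPolynomial in
theorem diffOp_cons {n : ℕ} (H : (Fin (n + 1) → ℤ) → ℤ) (a : ℤ) (l : Fin n → ℤ) :
    shiftHom (n + 1) (diffOp (n + 1)) H (Fin.cons a l) =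
      shiftHom n (diffOp n) (fun m => H (Fin.cons (a + 1) m) - H (Fin.cons a m)) l := by
  have hr : ∀ (P : MvPolynomial (Fin n) ℤ) (f : (Fin (n + 1) → ℤ) → ℤ),
      shiftHom (n + 1) (rename Fin.succ P) f (Fin.cons a l) =
        shiftHom n P (fun m => f (Fin.cons a m)) l := by
    intro P f
    have := shiftHom_transfer (fun m : Fin n → ℤ => (Fin.cons a m : Fin (n + 1) → ℤ))
      (rename Fin.succ) ?_ P f l
    · exact this.symm
    · intro p f k
      simp only [rename_X, shiftHom_X, Function.comp]
      congr 1
      ext i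
      refine Fin.cases ?_ (fun i => ?_) i
      · simp
      · simp [Pi.single_apply]
  have e : diffOp (n + 1) = rename Fin.succ (diffOp n) * (X 0 - 1) := by
    simp [diffOp, Fin.prod_univ_succ, mul_comm]
  rw [e, map_mul, Module.End.mul_apply, hr]
  refine congrFun (congrArg _ (funext fun m => ?_)) l
  simp only [map_sub, map_one, LinearMap.sub_apply, Pi.sub_apply, shiftHom_X, Module.End.one_apply]
  congr 2
  ext i
  refine Fin.cases ?_ (fun i => ?_) i <;> simp

theorem sum_interlacing_diffOp (n : ℕ) (H : (Fin n → ℤ) → ℤ)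
    (hH : ∀ i j : Fin n, (j : ℕ) = i + 1 → ∀ l : Fin n → ℤ, l i = l j →
      H l - H (l + Pi.single j 1) + H (l + Pi.single i 1 + Pi.single j 1) = 0)
    (k : Fin (n + 1) → ℤ)
    (hk : ∀ i : Fin n, k i.castSucc + (if (i : ℕ) = 0 then 0 else 1) ≤ k i.succ) :
    ∑ l ∈ interlacing k, shiftHom n (diffOp n) H l =
      ∑ r : Fin (n + 1), (-1) ^ (r : ℕ) *
        H (fun i => k (r.succAbove i) + if r ≤ i.castSucc then 1 else 0) := by
  induction n with
  | zero =>
    have h0 : interlacing k = {Fin.elim0} := by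
      ext l
      have h2 : StrictMono l := Subsingleton.strictMono _
      have : l = Fin.elim0 := Subsingleton.elim _ _
      rw [mem_interlacing]
      simp [h2, this.symm]
    simp [h0, diffOp]
    exact congrArg H (Subsingleton.elim _ _)
  | succ n ih =>
    have hk01 : k 0 ≤ k 1 := by simpa using hk 0
    have hd : ∀ a : ℤ, ∀ i j : Fin n, (j : ℕ) = i + 1 → ∀ l : Fin n → ℤ, l i = l j →
        H (Fin.cons a l) - H (Fin.cons a (l + Pi.single j 1)) +
          H (Fin.cons a (l + Pi.single i 1 + Pi.single j 1)) = 0 := by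
      intro a i j hij l hl
      have e : ∀ (m : Fin n → ℤ) (p : Fin n),
          (Fin.cons a (m + Pi.single p 1) : Fin (n + 1) → ℤ) =
            Fin.cons a m + Pi.single p.succ 1 := by
        intro m p
        ext q
        refine Fin.cases ?_ (fun q => ?_) q
        · simp
        · simp [Pi.single_apply]
      rw [e, e, e]
      exact hH i.succ j.succ (by simp [hij]) _ (by simpa using hl)
    have hd' : ∀ a : ℤ, ∀ i j : Fin n, (j : ℕ) = i + 1 → ∀ l : Fin n → ℤ, l i = l j →
        (fun m => H (Fin.cons (a + 1) m) - H (Fin.cons a m)) l -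
          (fun m => H (Fin.cons (a + 1) m) - H (Fin.cons a m)) (l + Pi.single j 1) +
          (fun m => H (Fin.cons (a + 1) m) - H (Fin.cons a m))
            (l + Pi.single i 1 + Pi.single j 1) = 0 := by
      intro a i j hij l hl
      have h1 := hd a i j hij l hl
      have h2 := hd (a + 1) i j hij l hl
      simp only
      linarith
    rw [sum_interlacing_succ k hk01]
    simp only [diffOp_cons]
    have hk1 : ∀ i : Fin n, (Fin.tail k) i.castSucc + (if (i : ℕ) = 0 then 0 else 1) ≤
        (Fin.tail k) i.succ := by
      intro i
      have := hk i.succ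
      simp only [Fin.tail, Fin.succ_castSucc]
      rw [if_neg (by simp)] at this
      split_ifs <;> omega
    have hk2 : ∀ i : Fin n, (Function.update (Fin.tail k) 0 (k 1 + 1)) i.castSucc +
        (if (i : ℕ) = 0 then 0 else 1) ≤ (Function.update (Fin.tail k) 0 (k 1 + 1)) i.succ := by
      intro i
      have := hk i.succ
      cases n with
      | zero => exact i.elim0
      | succ n =>
        refine Fin.cases ?_ (fun i => ?_) i
        · have := hk 1
          simpa [Fin.tail] using this
        · have := hk i.succ.succ
          simpa [Fin.tail, Function.update, Fin.ext_iff] using this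
    have e1 : ∀ a : ℤ, ∑ l ∈ interlacing (Fin.tail k),
        shiftHom n (diffOp n) (fun m => H (Fin.cons (a + 1) m) - H (Fin.cons a m)) l = _ :=
      fun a => ih _ (hd' a) (Fin.tail k) hk1
    simp only [e1, ih _ (hd' (k 1)) _ hk2]
    rw [Finset.sum_comm]
    simp only [← Finset.mul_sum]
    have e2 : ∀ m : Fin n → ℤ, ∑ a ∈ Finset.Ico (k 0) (k 1),
        (H (Fin.cons (a + 1) m) - H (Fin.cons a m)) = H (Fin.cons (k 1) m) - H (Fin.cons (k 0) m) :=
      fun m => sum_Ico_sub (fun a => H (Fin.cons a m)) _ _ hk01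
    simp only [e2]
    rw [Fin.sum_univ_succ (n := n + 1)]
    set v : Fin (n + 1) → Fin n → ℤ := fun r i =>
      Fin.tail k (r.succAbove i) + if r ≤ i.castSucc then 1 else 0 with hv
    set u : Fin (n + 1) → Fin n → ℤ := fun r i =>
      Function.update (Fin.tail k) 0 (k 1 + 1) (r.succAbove i) +
        if r ≤ i.castSucc then 1 else 0 with hu
    have e3 : ∀ s : Fin (n + 1), (fun i => k (s.succ.succAbove i) +
        if s.succ ≤ i.castSucc then (1 : ℤ) else 0) = Fin.cons (k 0) (v s) := by
      intro s
      ext i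
      refine Fin.cases ?_ (fun i => ?_) i
      · simp
      · simp [hv, Fin.tail]
    simp only [e3]
    have e4 : ∑ r : Fin (n + 1), (-1 : ℤ) ^ (r : ℕ) *
        (H (Fin.cons (k 1) (v r)) + (H (Fin.cons (k 1 + 1) (u r)) - H (Fin.cons (k 1) (u r)))) =
        H (fun i => k (Fin.succAbove 0 i) + if (0 : Fin (n + 2)) ≤ i.castSucc then 1 else 0) := by
      rw [Fin.sum_univ_succ]
      have h1 : v 0 = u 0 := by
        ext i; simp [hv, hu, Function.update]
      have h2 : (Fin.cons (k 1 + 1) (u 0) : Fin (n + 1) → ℤ) =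
          (fun i => k (Fin.succAbove 0 i) + if (0 : Fin (n + 2)) ≤ i.castSucc then 1 else 0) := by
        ext i
        refine Fin.cases ?_ (fun i => ?_) i
        · simp
        · simp [hu, Function.update, Fin.tail]
      rw [h1, h2, Finset.sum_eq_zero]
      · simp
      · intro s _
        cases n with
        | zero => exact s.elim0
        | succ n =>
          have h3 := hH 0 1 (by simp) (Fin.cons (k 1) (v s.succ)) (by
            have h6 : (Fin.cons (k 1) (v s.succ) : Fin (n + 2) → ℤ) 1 = v s.succ 0 := rfl
            rw [h6]
            simp [hv, Fin.tail])
          have h4 : (Fin.cons (k 1) (v s.succ) + Pi.single 1 1 : Fin (n + 2) → ℤ) =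
              Fin.cons (k 1) (u s.succ) := by
            ext i
            refine Fin.cases ?_ (fun i => Fin.cases ?_ (fun i => ?_) i) i
            · simp
            · rw [Fin.cons_succ, Pi.add_apply, Fin.cons_succ]
              simp [hu, hv, Fin.tail]
            · rw [Fin.cons_succ, Pi.add_apply, Fin.cons_succ]
              have h7 : (i.succ.succ : Fin (n + 2)) ≠ 1 := by
                rw [← Fin.succ_zero_eq_one, Ne, Fin.succ_inj]
                exact Fin.succ_ne_zero i
              rw [Pi.single_eq_of_ne h7]
              simp only [hu, hv, Fin.succ_succAbove_succ, Function.update_of_ne (Fin.succ_ne_zero _),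
                add_zero]
          have h5 : (Fin.cons (k 1) (v s.succ) + Pi.single 0 1 + Pi.single 1 1 :
              Fin (n + 2) → ℤ) = Fin.cons (k 1 + 1) (u s.succ) := by
            rw [add_right_comm, h4]
            ext i
            refine Fin.cases ?_ (fun i => ?_) i <;> simp
          rw [h4, h5] at h3
          rw [← add_sub_assoc, sub_eq_add_neg]
          have : H (Fin.cons (k 1) (v s.succ)) + H (Fin.cons (k 1 + 1) (u s.succ)) +
            -H (Fin.cons (k 1) (u s.succ)) = 0 := by linarith
          rw [this, mul_zero]
    rw [← e4, Fin.val_zero, pow_zero, one_mul, ← Finset.sum_add_distrib,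
      ← Finset.sum_add_distrib]
    refine Finset.sum_congr rfl fun r _ => ?_
    simp only [Fin.val_succ]
    ring

open MvPolynomial in
theorem shiftHom_diffOp_det (n : ℕ) :
    shiftHom n (diffOp n)
      (fun l => Matrix.det (Matrix.of fun i j : Fin n => Ring.choose (l i) ((j : ℕ) + 1))) =
      fun l => Matrix.det (Matrix.of fun i j : Fin n => Ring.choose (l i) (j : ℕ)) := by
  have h : ∀ s : Finset (Fin n), shiftHom n (∏ i ∈ s, (X i - 1))
      (fun l => Matrix.det (Matrix.of fun i j : Fin n => Ring.choose (l i) ((j : ℕ) + 1))) =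
      fun l => Matrix.det (Matrix.of fun i j : Fin n =>
        if i ∈ s then Ring.choose (l i) (j : ℕ) else Ring.choose (l i) ((j : ℕ) + 1)) := by
    intro s
    induction s using Finset.induction_on with
    | empty => simp
    | insert a s ha ih =>
      rw [Finset.prod_insert ha, map_mul, Module.End.mul_apply, ih]
      funext l
      simp only [map_sub, map_one, LinearMap.sub_apply, Pi.sub_apply, shiftHom_X,
        Module.End.one_apply]
      set M : Matrix (Fin n) (Fin n) ℤ := Matrix.of fun i j : Fin n =>
        if i ∈ s then Ring.choose (l i) (j : ℕ) else Ring.choose (l i) ((j : ℕ) + 1) with hM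
      have e1 : (Matrix.of fun i j : Fin n =>
          if i ∈ s then Ring.choose ((l + Pi.single a 1 : Fin n → ℤ) i) (j : ℕ)
          else Ring.choose ((l + Pi.single a 1 : Fin n → ℤ) i) ((j : ℕ) + 1)) =
          M.updateRow a ((fun j : Fin n => Ring.choose (l a) (j : ℕ)) +
            (fun j : Fin n => Ring.choose (l a) ((j : ℕ) + 1))) := by
        ext i j
        by_cases hi : i = a
        · subst hi
          simp [ha, Ring.choose_succ_succ]
        · simp [hM, hi]
      have e2 : M.updateRow a (fun j : Fin n => Ring.choose (l a) ((j : ℕ) + 1)) = M := by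
        ext i j
        by_cases hi : i = a
        · subst hi
          simp [hM, ha]
        · simp [hi]
      have e3 : M.updateRow a (fun j : Fin n => Ring.choose (l a) (j : ℕ)) = Matrix.of fun i j : Fin n =>
          if i ∈ insert a s then Ring.choose (l i) (j : ℕ)
          else Ring.choose (l i) ((j : ℕ) + 1) := by
        ext i j
        by_cases hi : i = a
        · subst hi
          simp
        · simp [hM, hi]
      rw [e1, Matrix.det_updateRow_add, e2, e3]
      ring
  simpa [diffOp] using h Finset.univ

/-- The factor `id + E_{k_p} E_{k_q} - E_{k_p}`. -/
noncomputable def alphaFactor {n : ℕ} (p q : Fin n) : MvPolynomial (Fin n) ℤ :=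
  1 + MvPolynomial.X p * MvPolynomial.X q - MvPolynomial.X p

theorem alphaOp_eq (n : ℕ) :
    alphaOp n = ∏ p : Fin n, ∏ q : Fin n, if p < q then alphaFactor p q else 1 := by
  unfold alphaOp alphaFactor
  refine Finset.prod_congr rfl fun p _ => ?_
  rw [← Finset.prod_filter]
  refine Finset.prod_congr ?_ fun _ _ => rfl
  ext q; simp

open MvPolynomial in
theorem alphaOp_symm {n : ℕ} (i j : Fin n) (hij : (j : ℕ) = i + 1) :
    rename (Equiv.swap i j) (alphaFactor j i * alphaOp n) = alphaFactor j i * alphaOp n := by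
  have hf : ∀ p q : Fin n, rename (Equiv.swap i j) (alphaFactor p q) =
      alphaFactor (Equiv.swap i j p) (Equiv.swap i j q) := by
    intro p q; simp [alphaFactor]
  have hne : i ≠ j := by
    intro h; rw [h] at hij; omega
  have hlt : ∀ p q : Fin n, (p, q) ≠ (i, j) → p < q →
      Equiv.swap i j p < Equiv.swap i j q ∧
        (Equiv.swap i j p, Equiv.swap i j q) ≠ (i, j) := by
    intro p q h1 h2
    simp only [Equiv.swap_apply_def, ne_eq, Prod.mk.injEq, Fin.ext_iff, Fin.lt_def] at *
    split_ifs <;> omega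
  set S : Finset (Fin n × Fin n) := Finset.univ.filter fun x => x.1 < x.2 ∧ x ≠ (i, j) with hS
  have hA : alphaOp n = alphaFactor i j * ∏ x ∈ S, alphaFactor x.1 x.2 := by
    have : insert (i, j) S = Finset.univ.filter fun x : Fin n × Fin n => x.1 < x.2 := by
      ext x
      simp only [hS, Finset.mem_insert, Finset.mem_filter, Finset.mem_univ, true_and]
      constructor
      · rintro (rfl | h)
        · exact Fin.lt_def.2 (by simp [hij])
        · exact h.1
      · intro h
        by_cases hx : x = (i, j)
        · exact Or.inl hx
        · exact Or.inr ⟨h, hx⟩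
    have h1 := Finset.prod_insert (f := fun x : Fin n × Fin n => alphaFactor x.1 x.2)
      (show (i, j) ∉ S by simp [hS])
    rw [← h1, this, Finset.prod_filter, alphaOp_eq, ← Finset.univ_product_univ, Finset.prod_product]
  have hP : rename (Equiv.swap i j) (∏ x ∈ S, alphaFactor x.1 x.2) =
      ∏ x ∈ S, alphaFactor x.1 x.2 := by
    rw [map_prod]
    refine Finset.prod_bij' (fun x _ => (Equiv.swap i j x.1, Equiv.swap i j x.2))
      (fun x _ => (Equiv.swap i j x.1, Equiv.swap i j x.2)) ?_ ?_ ?_ ?_ ?_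
    · intro x hx
      simp only [hS, Finset.mem_filter, Finset.mem_univ, true_and] at hx ⊢
      exact hlt x.1 x.2 hx.2 hx.1
    · intro x hx
      simp only [hS, Finset.mem_filter, Finset.mem_univ, true_and] at hx ⊢
      exact hlt x.1 x.2 hx.2 hx.1
    · intro x _; simp
    · intro x _; simp
    · intro x _; exact hf _ _
  rw [hA, map_mul, map_mul, hf, hf, hP]
  simp only [Equiv.swap_apply_left, Equiv.swap_apply_right]
  ring

open MvPolynomial in
theorem alphaOp_vanish {n : ℕ} (D : (Fin n → ℤ) → ℤ) (i j : Fin n) (hij : (j : ℕ) = i + 1)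
    (hD : ∀ k : Fin n → ℤ, D (k ∘ Equiv.swap i j) = -D k)
    (k : Fin n → ℤ) (hk : k i = k j) :
    shiftHom n (alphaOp n) D k - shiftHom n (alphaOp n) D (k + Pi.single j 1) +
      shiftHom n (alphaOp n) D (k + Pi.single i 1 + Pi.single j 1) = 0 := by
  have hks : k ∘ Equiv.swap i j = k := by
    funext q
    simp only [Function.comp, Equiv.swap_apply_def]
    split_ifs with h1 h2
    · rw [h1, hk]
    · rw [h2, hk]
    · rfl
  have h1 := shiftHom_transfer (fun k : Fin n → ℤ => k ∘ Equiv.swap i j)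
    (rename (Equiv.swap i j)) (by
      intro p f k
      simp only [rename_X, shiftHom_X, Function.comp_apply]
      congr 1
      ext q
      have : q = Equiv.swap i j p ↔ Equiv.swap i j q = p := by
        constructor
        · rintro rfl; simp
        · rintro rfl; simp
      simp [Pi.single_apply, this]) (alphaFactor j i * alphaOp n) D k
  rw [alphaOp_symm i j hij, hks] at h1
  have h2 : D ∘ (fun k : Fin n → ℤ => k ∘ Equiv.swap i j) = -D := by
    funext k; exact hD k
  rw [h2, map_neg, Pi.neg_apply] at h1
  have h3 : shiftHom n (alphaFactor j i * alphaOp n) D k = 0 := by omega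
  rw [map_mul, Module.End.mul_apply] at h3
  simp only [alphaFactor, map_sub, map_add, map_mul, map_one, LinearMap.sub_apply,
    LinearMap.add_apply, Pi.sub_apply, Pi.add_apply, shiftHom_X, Module.End.one_apply,
    Module.End.mul_apply] at h3
  rw [add_right_comm k]
  linarith

open MvPolynomial in
theorem shiftHom_alphaOp_succAbove {n : ℕ} (r : Fin (n + 1)) (D : (Fin n → ℤ) → ℤ)
    (k : Fin (n + 1) → ℤ) :
    shiftHom (n + 1) (alphaOp (n + 1)) (fun k => D (fun i => k (r.succAbove i))) k =
      shiftHom n (alphaOp n) D (fun i => k (r.succAbove i) + if r ≤ i.castSucc then 1 else 0) := by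
  set φ : MvPolynomial (Fin (n + 1)) ℤ →ₐ[ℤ] MvPolynomial (Fin n) ℤ :=
    aeval (r.insertNth (α := fun _ => MvPolynomial (Fin n) ℤ) 1 X) with hφ
  have hr : φ (X r) = 1 := by simp [hφ]
  have hs : ∀ i, φ (X (r.succAbove i)) = X i := by intro i; simp [hφ]
  have h1 := shiftHom_transfer (fun k : Fin (n + 1) → ℤ => fun i => k (r.succAbove i)) φ (by
      intro p f k
      refine r.succAboveCases ?_ (fun p => ?_) p
      · rw [hr, map_one, shiftHom_X, Module.End.one_apply]
        simp only [Function.comp_apply]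
        congr 1
        ext i
        simp
      · rw [hs, shiftHom_X, shiftHom_X]
        simp only [Function.comp_apply]
        congr 1
        ext i
        simp [Pi.single_apply]) (alphaOp (n + 1)) D k
  have h2 : φ (alphaOp (n + 1)) =
      (∏ i : Fin n, if r ≤ i.castSucc then X i else 1) * alphaOp n := by
    rw [alphaOp_eq, alphaOp_eq, Fin.prod_univ_succAbove _ r]
    simp only [Fin.prod_univ_succAbove _ r, map_mul, map_prod, lt_irrefl, if_false, map_one,
      one_mul, Fin.succAbove_lt_succAbove_iff, apply_ite φ, alphaFactor, map_sub, map_add, hr, hs]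
    simp [Fin.lt_succAbove_iff_le_castSucc]
  have h3 : ∀ (s : Finset (Fin n)) (f : (Fin n → ℤ) → ℤ) (k : Fin n → ℤ),
      shiftHom n (∏ i ∈ s, if r ≤ i.castSucc then X i else 1) f k =
        f (fun i => k i + if i ∈ s ∧ r ≤ i.castSucc then 1 else 0) := by
    intro s
    induction s using Finset.induction_on with
    | empty => intro f k; simp
    | insert a s ha ih =>
      intro f k
      rw [Finset.prod_insert ha, mul_comm, map_mul, Module.End.mul_apply, ih]
      by_cases h : r ≤ a.castSucc
      · rw [if_pos h, shiftHom_X]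
        congr 1
        ext i
        by_cases hi : i = a
        · subst hi; simp [ha, h]
        · simp [hi]
      · rw [if_neg h, map_one, Module.End.one_apply]
        congr 1
        ext i
        by_cases hi : i = a
        · subst hi; simp [ha, h]
        · simp [hi]
  rw [h2, map_mul, Module.End.mul_apply, h3] at h1
  simpa [Function.comp_def] using h1

theorem alpha_succ {n : ℕ} (k : Fin (n + 1) → ℤ) (hk : StrictMono k) :
    alpha (n + 1) k = ∑ l ∈ interlacing k, alpha n l := by
  set D : (Fin n → ℤ) → ℤ := fun l =>
    Matrix.det (Matrix.of fun i j : Fin n => Ring.choose (l i) ((j : ℕ) + 1)) with hD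
  have h1 := sum_interlacing_diffOp n (shiftHom n (alphaOp n) D) (by
    intro i j hij l hl
    refine alphaOp_vanish D i j hij ?_ l hl
    intro k
    have hne : i ≠ j := by
      intro h; rw [h] at hij; omega
    have := Matrix.det_permute (Equiv.swap i j)
      (Matrix.of fun i j : Fin n => Ring.choose (k i) ((j : ℕ) + 1))
    rw [Equiv.Perm.sign_swap hne] at this
    simp only [hD]
    simpa [Matrix.submatrix] using this) k (by
    intro i
    have := hk (Fin.castSucc_lt_succ (i := i))
    split_ifs <;> omega)
  have h2 : ∀ l, shiftHom n (diffOp n) (shiftHom n (alphaOp n) D) l = alpha n l := by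
    intro l
    rw [← Module.End.mul_apply, ← map_mul, mul_comm, map_mul, Module.End.mul_apply, hD,
      shiftHom_diffOp_det]
    rfl
  simp only [h2] at h1
  rw [h1]
  have h3 : (fun k : Fin (n + 1) → ℤ =>
      Matrix.det (Matrix.of fun i j : Fin (n + 1) => Ring.choose (k i) (j : ℕ))) =
      ∑ r : Fin (n + 1), ((-1 : ℤ) ^ (r : ℕ)) • fun k => D (fun i => k (r.succAbove i)) := by
    funext k
    rw [Matrix.det_succ_column_zero, Finset.sum_apply]
    refine Finset.sum_congr rfl fun r _ => ?_
    simp [hD, Matrix.submatrix]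
  rw [alpha, h3, map_sum, Finset.sum_apply]
  refine Finset.sum_congr rfl fun r _ => ?_
  rw [map_smul, Pi.smul_apply, shiftHom_alphaOp_succAbove, smul_eq_mul]

theorem init_bijOn {n : ℕ} (k : Fin (n + 1) → ℤ) (hk : StrictMono k) :
    Set.BijOn (fun (a : (i : Fin (n + 2)) → Fin i → ℤ) (i : Fin (n + 1)) => a i.castSucc)
      (monotoneTriangles (n + 1) k) (⋃ l ∈ interlacing k, monotoneTriangles n l) := by
  refine ⟨?_, ?_, ?_⟩
  · rintro a ⟨ha, rfl⟩
    simp only [Set.mem_iUnion]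
    refine ⟨a (Fin.last n).castSucc, ?_, ⟨fun i => ha.strictMono _, fun i j => ?_⟩, rfl⟩
    · rw [mem_interlacing]
      exact ⟨fun i => ha.interlace (Fin.last n) i, ha.strictMono _⟩
    · exact ha.interlace i.castSucc j
  · rintro a ⟨ha, ha'⟩ b ⟨hb, hb'⟩ hab
    funext i
    refine Fin.lastCases ?_ (fun i => ?_) i
    · rw [ha', hb']
    · exact congrFun hab i
  · intro b hb
    simp only [Set.mem_iUnion] at hb
    obtain ⟨l, hl, hb, hb'⟩ := hb
    rw [mem_interlacing] at hl
    set a : (i : Fin (n + 2)) → Fin i → ℤ :=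
      Fin.lastCases (motive := fun i : Fin (n + 2) => Fin i → ℤ) k (fun i => b i) with ha
    have h1 : a (Fin.last (n + 1)) = k := by simp [ha]
    have h2 : ∀ i : Fin (n + 1), a i.castSucc = b i := by intro i; simp [ha]
    refine ⟨a, ⟨⟨?_, ?_⟩, h1⟩, funext h2⟩
    · intro i
      refine Fin.lastCases ?_ (fun i => ?_) i
      · rw [h1]; exact hk
      · rw [h2]; exact hb.strictMono i
    · intro i
      refine Fin.lastCases ?_ (fun i => ?_) i
      · intro j
        have e1 : a (Fin.last n).castSucc = l := by rw [h2, hb']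
        have e2 : a (Fin.last n).succ = k := h1
        rw [e1, e2]
        exact hl.1 j
      · intro j
        have e1 : a i.castSucc.castSucc = b i.castSucc := h2 _
        have e2 : a i.castSucc.succ = b i.succ := h2 i.succ
        rw [e1, e2]
        exact hb.interlace i j

theorem alpha_eq_ncard_aux (n : ℕ) (k : Fin n → ℤ) (hk : StrictMono k) :
    (monotoneTriangles n k).Finite ∧ ((monotoneTriangles n k).ncard : ℤ) = alpha n k := by
  induction n with
  | zero =>
    have h : monotoneTriangles 0 k = {fun _ _ => 0} := by
      ext a
      have hs : ∀ i : Fin 1, IsEmpty (Fin i) := by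
        intro i
        have : (i : ℕ) = 0 := by omega
        rw [this]; infer_instance
      have : ∀ b c : (i : Fin 1) → Fin i → ℤ, b = c := by
        intro b c
        funext i j
        exact (hs i).elim j
      simp only [monotoneTriangles, Set.mem_ofPred_eq, Set.mem_singleton_iff]
      refine ⟨fun _ => this _ _, fun _ => ⟨⟨fun i => ?_, fun i => i.elim0⟩, ?_⟩⟩
      · intro x; exact (hs i).elim x
      · funext x; exact x.elim0
    rw [h]
    simp [alpha, alphaOp]
  | succ n ih =>
    have hb := init_bijOn k hk
    have hm : ∀ l ∈ interlacing k, StrictMono l := fun l hl => ((mem_interlacing k l).1 hl).2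
    have hf : (⋃ l ∈ interlacing k, monotoneTriangles n l).Finite :=
      Set.Finite.biUnion (interlacing k).finite_toSet fun l hl => (ih l (hm l hl)).1
    refine ⟨hb.finite_iff_finite.2 hf, ?_⟩
    rw [hb.ncard_eq, alpha_succ k hk, Set.ncard_eq_toFinset_card _ hf,
      Finset.card_eq_sum_card_fiberwise (f := fun a : (i : Fin (n + 1)) → Fin i → ℤ =>
        (a (Fin.last n) : Fin n → ℤ)) (t := interlacing k), Nat.cast_sum]
    · refine Finset.sum_congr rfl fun l hl => ?_
      rw [← (ih l (hm l hl)).2, ← Set.ncard_coe_finset]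
      congr 2
      ext a
      simp only [Finset.coe_filter, Set.Finite.mem_toFinset, Set.mem_iUnion, Set.mem_ofPred_eq]
      constructor
      · rintro ⟨⟨m, hm, h1⟩, h2⟩
        exact ⟨h1.1, h2⟩
      · intro h
        exact ⟨⟨l, hl, h⟩, h.2⟩
    · intro a ha
      simp only [Set.Finite.coe_toFinset, Set.mem_iUnion] at ha
      obtain ⟨l, hl, h⟩ := ha
      have := h.2
      simpa [this] using hl

/-- For strictly increasing integers `k_1 < ⋯ < k_n`, the value `α(n; k_1, …, k_n)` is the number
of monotone triangles with bottom row `(k_1, …, k_n)`. -/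
theorem alpha_eq_ncard (n : ℕ) (k : Fin n → ℤ) (hk : StrictMono k) :
    alpha n k = (monotoneTriangles n k).ncard :=
  (alpha_eq_ncard_aux n k hk).2.symm

/-- The function `f` on `ℤⁿ` is given by a polynomial with rational coefficients. -/
def IsPolyFun {n : ℕ} (f : (Fin n → ℤ) → ℤ) : Prop :=
  ∃ P : MvPolynomial (Fin n) ℚ, ∀ k : Fin n → ℤ, P.eval (fun i => (k i : ℚ)) = f k

theorem IsPolyFun.add {n : ℕ} {f g : (Fin n → ℤ) → ℤ} (hf : IsPolyFun f) (hg : IsPolyFun g) :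
    IsPolyFun (f + g) := by
  obtain ⟨P, hP⟩ := hf
  obtain ⟨Q, hQ⟩ := hg
  exact ⟨P + Q, fun k => by simp [hP, hQ]⟩

theorem IsPolyFun.mul {n : ℕ} {f g : (Fin n → ℤ) → ℤ} (hf : IsPolyFun f) (hg : IsPolyFun g) :
    IsPolyFun (f * g) := by
  obtain ⟨P, hP⟩ := hf
  obtain ⟨Q, hQ⟩ := hg
  exact ⟨P * Q, fun k => by simp [hP, hQ]⟩

theorem isPolyFun_const {n : ℕ} (a : ℤ) : IsPolyFun (fun _ : Fin n → ℤ => a) :=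
  ⟨MvPolynomial.C (a : ℚ), fun k => by simp⟩

theorem isPolyFun_choose {n : ℕ} (i : Fin n) (j : ℕ) :
    IsPolyFun (fun k : Fin n → ℤ => Ring.choose (k i) j) := by
  refine ⟨MvPolynomial.C (1 / (j.factorial : ℚ)) *
    Polynomial.aeval (MvPolynomial.X i : MvPolynomial (Fin n) ℚ) (descPochhammer ℚ j),
    fun k => ?_⟩
  have h := Ring.descPochhammer_eq_factorial_smul_choose (k i) j
  have h2 : ((descPochhammer ℚ j).eval (k i : ℚ)) = j.factorial * (Ring.choose (k i) j : ℤ) := by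
    rw [← Polynomial.eval_eq_smeval] at h
    rw [← descPochhammer_map (Int.castRingHom ℚ), Polynomial.eval_map, ← eq_intCast
      (Int.castRingHom ℚ) (k i), Polynomial.eval₂_at_apply, h]
    simp
  have h3 : MvPolynomial.eval (fun i => (k i : ℚ))
      (Polynomial.aeval (MvPolynomial.X i : MvPolynomial (Fin n) ℚ) (descPochhammer ℚ j)) =
      (descPochhammer ℚ j).eval (k i : ℚ) := by
    rw [Polynomial.aeval_def, Polynomial.hom_eval₂, Polynomial.eval₂_eq_eval_map]
    simp
  rw [map_mul, MvPolynomial.eval_C, h3, h2]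
  field_simp

theorem IsPolyFun.sum {n : ℕ} {ι : Type} (s : Finset ι) (f : ι → (Fin n → ℤ) → ℤ)
    (h : ∀ i ∈ s, IsPolyFun (f i)) : IsPolyFun (∑ i ∈ s, f i) :=
  Finset.sum_induction _ _ (fun _ _ => IsPolyFun.add) (isPolyFun_const 0) h

theorem IsPolyFun.prod {n : ℕ} {ι : Type} (s : Finset ι) (f : ι → (Fin n → ℤ) → ℤ)
    (h : ∀ i ∈ s, IsPolyFun (f i)) : IsPolyFun (∏ i ∈ s, f i) :=
  Finset.prod_induction _ _ (fun _ _ => IsPolyFun.mul) (isPolyFun_const 1) h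

theorem IsPolyFun.shiftHom {n : ℕ} (P : MvPolynomial (Fin n) ℤ) {f : (Fin n → ℤ) → ℤ}
    (hf : IsPolyFun f) : IsPolyFun (shiftHom n P f) := by
  induction P using MvPolynomial.induction_on generalizing f with
  | C a =>
    rw [← MvPolynomial.algebraMap_eq, AlgHom.commutes]
    exact (isPolyFun_const a).mul hf
  | add p q hp hq =>
    rw [map_add]
    exact (hp hf).add (hq hf)
  | mul_X P p ih =>
    rw [map_mul, Module.End.mul_apply]
    refine ih ?_
    obtain ⟨Q, hQ⟩ := hf
    refine ⟨MvPolynomial.bind₁ (fun i => MvPolynomial.X i +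
      MvPolynomial.C ((Pi.single p 1 : Fin n → ℚ) i)) Q, fun k => ?_⟩
    rw [shiftHom_X, ← hQ, MvPolynomial.eval, MvPolynomial.eval₂Hom_bind₁]
    congr 2
    ext i
    by_cases hi : i = p
    · subst hi; simp
    · simp [hi]

/-- `α(n; k_1, …, k_n)` is a polynomial in `k_1, …, k_n`. -/
theorem isPolyFun_alpha (n : ℕ) : IsPolyFun (alpha n) := by
  refine IsPolyFun.shiftHom _ ?_
  have : (fun k : Fin n → ℤ => Matrix.det (Matrix.of fun i j : Fin n =>
      Ring.choose (k i) (j : ℕ))) = ∑ σ : Equiv.Perm (Fin n),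
        (fun _ => ((Equiv.Perm.sign σ : ℤˣ) : ℤ)) *
          ∏ i : Fin n, fun k : Fin n → ℤ => Ring.choose (k (σ i)) (i : ℕ) := by
    funext k
    rw [Matrix.det_apply', Finset.sum_apply]
    simp [Finset.prod_apply]
  rw [this]
  exact IsPolyFun.sum _ _ fun σ _ => (isPolyFun_const _).mul
    (IsPolyFun.prod _ _ fun i _ => isPolyFun_choose _ _)

/-! Put `p k₁ = α(n; k₁, 2d, …, nd)`. Two facts about `p` suffice: `Δ^n p = 0`
(`fwdDiff_iterate_alphaRow`), and `p t = (-1)^(n-1) p (S - t)` with `S = (n+2)d + n`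
(`alphaRow_reflect`). Summing or differencing the symmetry turns it into one between the iterated
(inverse) differences, with `x_j` replaced by `z_j = S - x_j - j - 2` and the point `k` by `S - k -
i` (`deltaPow_reflect`). At `k = d + 1` the new point is `(d + 1) + N` with `N = n(d+1) - i - 2`.
Newton's formula for the shift by `N` gives the binomial sum, and `Δ^n p = 0` stops it at `j = n -
1` (`deltaPow_add_natCast`).

The symmetry of `p` combines translation invariance of `α` (`alpha_add_one`), its reflection
symmetry (`alpha_neg_rev`), and the rotation rule, by which moving the first argument to the last
place costs a shift by `n` and a sign (`alpha_comp_finRotate`). All three are computed modulo the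
ideal of operators killing the determinant. That ideal contains every elementary symmetric
polynomial of positive degree `≤ n` in the differences `Δ_{k_i}`, so `∏ (a + b Δ_{k_i})` acts on the
determinant as `a^n` for arbitrary operators `a`, `b` (`prod_sub_pow_mem_chooseDetAnn`). -/

/-! ### Operators that annihilate the binomial determinant. -/

/-- The determinant `det (binom (k_i) (j-1))_{1 ≤ i, j ≤ n}` as a function of `k`. -/
noncomputable def chooseDet (n : ℕ) (k : Fin n → ℤ) : ℤ :=
  Matrix.det (Matrix.of fun i j : Fin n => Ring.choose (k i) (j : ℕ))

theorem alpha_eq (n : ℕ) : alpha n = shiftHom n (alphaOp n) (chooseDet n) := rfl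

/-- The forward difference of `x ↦ binom x j`. -/
noncomputable def choosePred (x : ℤ) : ℕ → ℤ
  | 0 => 0
  | j + 1 => Ring.choose x j

theorem choose_add_one (x : ℤ) (j : ℕ) :
    Ring.choose (x + 1) j = Ring.choose x j + choosePred x j := by
  cases j with
  | zero => simp [choosePred]
  | succ j => rw [Ring.choose_succ_succ, choosePred, add_comm]

/-- Each factor `id + tΔ_{k_a}` touches only row `a`, in which the determinant is linear; Pascal's
rule gives the difference of that row. -/
theorem shiftHom_prod_chooseDet {n : ℕ} (t : ℤ) (s : Finset (Fin n)) :
    shiftHom n (∏ i ∈ s, (1 + MvPolynomial.C t * (MvPolynomial.X i - 1))) (chooseDet n) =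
      fun l => Matrix.det (Matrix.of fun i j : Fin n =>
        Ring.choose (l i) (j : ℕ) + if i ∈ s then t * choosePred (l i) j else 0) := by
  induction s using Finset.induction_on with
  | empty => funext l; simp [chooseDet]
  | insert a s ha ih =>
    rw [Finset.prod_insert ha, map_mul, Module.End.mul_apply, ih]
    funext l
    have hC : ∀ P : MvPolynomial (Fin n) ℤ, MvPolynomial.C t * P = t • P := fun P =>
      (MvPolynomial.smul_eq_C_mul P t).symm
    simp only [hC, map_add, map_smul, map_sub, map_one, LinearMap.add_apply, LinearMap.smul_apply,
      LinearMap.sub_apply, Pi.add_apply, Pi.smul_apply, Pi.sub_apply, shiftHom_X,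
      Module.End.one_apply, smul_eq_mul]
    set N : Matrix (Fin n) (Fin n) ℤ := Matrix.of fun i j : Fin n =>
      Ring.choose (l i) (j : ℕ) + if i ∈ s then t * choosePred (l i) j else 0 with hN
    set r : Fin n → ℤ := fun j => choosePred (l a) j with hr
    have e1 : (Matrix.of fun i j : Fin n =>
        Ring.choose ((l + Pi.single a 1 : Fin n → ℤ) i) (j : ℕ) +
          if i ∈ s then t * choosePred ((l + Pi.single a 1 : Fin n → ℤ) i) j else 0) =
        N.updateRow a (N a + r) := by
      ext i j
      by_cases hi : i = a
      · subst hi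
        simp [ha, hN, hr, choose_add_one]
      · simp [hN, hi]
    have e2 : (Matrix.of fun i j : Fin n => Ring.choose (l i) (j : ℕ) +
        if i ∈ insert a s then t * choosePred (l i) j else 0) =
        N.updateRow a (N a + t • r) := by
      ext i j
      by_cases hi : i = a
      · subst hi
        simp [ha, hN, hr]
      · simp [hN, hi]
    simp only [Pi.add_apply l] at e1
    rw [e1, e2, Matrix.det_updateRow_add, Matrix.det_updateRow_add, Matrix.det_updateRow_smul,
      Matrix.updateRow_eq_self]
    ring

/-- The modified matrix arises by adding `t` times each column to the next one, that is, by right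
multiplication with a unitriangular matrix. -/
theorem det_choose_add_mul_choosePred {n : ℕ} (t : ℤ) (l : Fin n → ℤ) :
    Matrix.det (Matrix.of fun i j : Fin n =>
      Ring.choose (l i) (j : ℕ) + t * choosePred (l i) j) = chooseDet n l := by
  set U : Matrix (Fin n) (Fin n) ℤ := Matrix.of fun i j =>
    if i = j then 1 else if (i : ℕ) + 1 = j then t else 0 with hU
  have hdet : U.det = 1 := by
    rw [Matrix.det_of_isUpperTriangular]
    · simp [hU]
    · intro i j hij
      have hij' : j < i := hij
      have h1 : i ≠ j := hij'.ne'
      have h2 : ¬ (i : ℕ) + 1 = j := by have := Fin.lt_def.1 hij'; omega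
      simp [hU, h1, h2]
  have hmul : (Matrix.of fun i j : Fin n =>
      Ring.choose (l i) (j : ℕ) + t * choosePred (l i) j) =
      (Matrix.of fun i j : Fin n => Ring.choose (l i) (j : ℕ)) * U := by
    ext i j
    rw [Matrix.mul_apply]
    have hsplit : ∀ m : Fin n, (if m = j then (1 : ℤ) else if (m : ℕ) + 1 = j then t else 0) =
        (if m = j then 1 else 0) + if (m : ℕ) + 1 = j then t else 0 := by
      intro m
      by_cases h : m = j
      · subst h; simp
      · simp [h]
    simp only [hU, Matrix.of_apply, hsplit, mul_add, Finset.sum_add_distrib, mul_ite, mul_one,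
      mul_zero, Finset.sum_ite_eq', Finset.mem_univ, if_true]
    congr 1
    obtain ⟨j, hj⟩ := j
    cases j with
    | zero => simp [choosePred]
    | succ j =>
      have : ∀ m : Fin n, (m : ℕ) + 1 = j + 1 ↔ m = ⟨j, by omega⟩ := by
        intro m; simp [Fin.ext_iff]
      simp only [this, Finset.sum_ite_eq', Finset.mem_univ, if_true, choosePred]
      ring
  rw [hmul, Matrix.det_mul, hdet, mul_one, chooseDet]

/-- The ideal of operators that annihilate `chooseDet n`. -/
noncomputable def chooseDetAnn (n : ℕ) : Ideal (MvPolynomial (Fin n) ℤ) where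
  carrier := {P | shiftHom n P (chooseDet n) = 0}
  add_mem' := by
    intro P Q hP hQ
    simp only [Set.mem_ofPred_eq] at *
    rw [map_add, LinearMap.add_apply, hP, hQ, add_zero]
  zero_mem' := by simp
  smul_mem' := by
    intro P Q hQ
    simp only [Set.mem_ofPred_eq, smul_eq_mul] at *
    rw [map_mul, Module.End.mul_apply, hQ, map_zero]

theorem mem_chooseDetAnn {n : ℕ} {P : MvPolynomial (Fin n) ℤ} :
    P ∈ chooseDetAnn n ↔ shiftHom n P (chooseDet n) = 0 := Iff.rfl

theorem shiftHom_eq_of_sub_mem {n : ℕ} {P Q : MvPolynomial (Fin n) ℤ}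
    (h : P - Q ∈ chooseDetAnn n) :
    shiftHom n P (chooseDet n) = shiftHom n Q (chooseDet n) := by
  rw [mem_chooseDetAnn, map_sub, LinearMap.sub_apply] at h
  exact sub_eq_zero.1 h

/-- The elementary symmetric polynomial of degree `j` in the difference operators. -/
noncomputable def esymmDiff (n j : ℕ) : MvPolynomial (Fin n) ℤ :=
  ∑ s ∈ Finset.powersetCard j (Finset.univ : Finset (Fin n)), ∏ i ∈ s, (MvPolynomial.X i - 1)

theorem prod_add_mul_diff {n : ℕ} (a b : MvPolynomial (Fin n) ℤ) :
    ∏ i : Fin n, (a + b * (MvPolynomial.X i - 1)) =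
      ∑ j ∈ Finset.range (n + 1), b ^ j * a ^ (n - j) * esymmDiff n j := by
  simp only [add_comm a]
  rw [Finset.prod_add, Finset.sum_powerset, Finset.card_univ, Fintype.card_fin]
  refine Finset.sum_congr rfl fun j _ => ?_
  rw [esymmDiff, Finset.mul_sum]
  refine Finset.sum_congr rfl fun s hs => ?_
  have hc := (Finset.mem_powersetCard.1 hs).2
  rw [Finset.prod_mul_distrib, Finset.prod_const, Finset.prod_const,
    Finset.card_sdiff_of_subset (Finset.subset_univ _), Finset.card_univ, Fintype.card_fin, hc]
  ring

theorem esymmDiff_mem_chooseDetAnn {n j : ℕ} (hj : j ≠ 0) (hjn : j ≤ n) :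
    esymmDiff n j ∈ chooseDetAnn n := by
  rw [mem_chooseDetAnn]
  funext k
  -- `Q` is the generating polynomial in `t` of the values of the elementary symmetric operators. It
  -- agrees at every integer `t` with the action of `∏ (id + tΔ_{k_i})`, which is constant in `t`,
  -- so its higher coefficients vanish.
  set Q : Polynomial ℤ := ∑ i ∈ Finset.range (n + 1),
    Polynomial.monomial i (shiftHom n (esymmDiff n i) (chooseDet n) k) with hQ
  have h : Q = Polynomial.C (chooseDet n k) := by
    refine Polynomial.funext fun t => ?_
    have h1 := congrFun (shiftHom_prod_chooseDet t (Finset.univ : Finset (Fin n))) k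
    simp only [Finset.mem_univ, if_true] at h1
    rw [det_choose_add_mul_choosePred, prod_add_mul_diff] at h1
    rw [Polynomial.eval_C, ← h1, hQ, Polynomial.eval_finsetSum, map_sum, LinearMap.sum_apply,
      Finset.sum_apply]
    refine Finset.sum_congr rfl fun i _ => ?_
    rw [Polynomial.eval_monomial, one_pow, mul_one, ← map_pow, ← MvPolynomial.smul_eq_C_mul,
      map_smul, LinearMap.smul_apply, Pi.smul_apply, smul_eq_mul, mul_comm]
  have h2 := congrArg (fun P => Polynomial.coeff P j) h
  simp only [hQ, Polynomial.finsetSum_coeff, Polynomial.coeff_monomial, Polynomial.coeff_C,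
    if_neg hj, Finset.sum_ite_eq'] at h2
  rwa [if_pos (Finset.mem_range.2 (by omega))] at h2

/-- In the expansion by elementary symmetric polynomials only the degree-zero term survives. Since
`a` and `b` may themselves contain shifts, specialising them yields all the annihilation relations
used below. -/
theorem prod_sub_pow_mem_chooseDetAnn {n : ℕ} (a b : MvPolynomial (Fin n) ℤ) :
    ∏ i : Fin n, (a + b * (MvPolynomial.X i - 1)) - a ^ n ∈ chooseDetAnn n := by
  rw [prod_add_mul_diff, Finset.sum_range_succ']
  have h0 : esymmDiff n 0 = 1 := by simp [esymmDiff]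
  rw [h0, pow_zero, one_mul, mul_one, Nat.sub_zero, add_sub_cancel_right]
  refine Ideal.sum_mem _ fun j hj => Ideal.mul_mem_left _ _ ?_
  exact esymmDiff_mem_chooseDetAnn (Nat.succ_ne_zero j) (Finset.mem_range.1 hj)

theorem sub_one_pow_mem_chooseDetAnn {n : ℕ} (p : Fin n) :
    (MvPolynomial.X p - 1) ^ n ∈ chooseDetAnn n := by
  -- With `a = Δ_{k_p}` and `b = -1` the factor at `p` is zero, so only `-a^n` is left.
  have h := prod_sub_pow_mem_chooseDetAnn (MvPolynomial.X p - 1 : MvPolynomial (Fin n) ℤ) (-1)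
  rw [Finset.prod_eq_zero (Finset.mem_univ p) (by ring), zero_sub] at h
  exact (Ideal.neg_mem_iff _).1 h

theorem prod_X_sub_one_mem_chooseDetAnn (n : ℕ) :
    ∏ i : Fin n, MvPolynomial.X i - 1 ∈ chooseDetAnn n := by
  simpa using prod_sub_pow_mem_chooseDetAnn (1 : MvPolynomial (Fin n) ℤ) 1

/-! ### Translation and rotation of `α`. -/

theorem shiftHom_comp {n : ℕ} (g : (Fin n → ℤ) → (Fin n → ℤ)) (e : Equiv.Perm (Fin n))
    (hg : ∀ k p, g (k + Pi.single p 1) = g k + Pi.single (e p) 1) (P : MvPolynomial (Fin n) ℤ)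
    (f : (Fin n → ℤ) → ℤ) (k : Fin n → ℤ) :
    shiftHom n P (f ∘ g) k = shiftHom n (MvPolynomial.rename e P) f (g k) :=
  shiftHom_transfer g (MvPolynomial.rename e)
    (by intro p f k; simp [shiftHom_X, hg]) P f k

theorem shiftHom_prod_X {n : ℕ} (s : Finset (Fin n)) (f : (Fin n → ℤ) → ℤ) (k : Fin n → ℤ) :
    shiftHom n (∏ i ∈ s, MvPolynomial.X i) f k = f (k + ∑ i ∈ s, Pi.single i 1) := by
  induction s using Finset.induction_on generalizing k with
  | empty => simp
  | insert a s ha ih =>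
    rw [Finset.prod_insert ha, map_mul, Module.End.mul_apply, shiftHom_X, ih,
      Finset.sum_insert ha, add_assoc]

theorem shiftHom_X_pow {n : ℕ} (p : Fin n) (m : ℕ) (f : (Fin n → ℤ) → ℤ) (k : Fin n → ℤ) :
    shiftHom n (MvPolynomial.X p ^ m) f k = f (k + Pi.single p (m : ℤ)) := by
  induction m generalizing k with
  | zero => simp
  | succ m ih =>
    rw [pow_succ', map_mul, Module.End.mul_apply, shiftHom_X, ih, add_assoc, ← Pi.single_add]
    push_cast
    rw [add_comm (m : ℤ)]

/-- Shifting all arguments is the operator `∏ E_{k_i}`, which commutes with `alphaOp` and fixes the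
determinant. -/
theorem alpha_add_one (n : ℕ) (k : Fin n → ℤ) : alpha n (k + 1) = alpha n k := by
  have h1 : (∑ i : Fin n, Pi.single i (1 : ℤ) : Fin n → ℤ) = 1 :=
    Finset.univ_sum_single (1 : Fin n → ℤ)
  rw [← h1, ← shiftHom_prod_X Finset.univ (alpha n) k, alpha_eq, ← Module.End.mul_apply, ← map_mul, mul_comm]
  refine congrFun (shiftHom_eq_of_sub_mem ?_) k
  rw [show alphaOp n * ∏ i : Fin n, MvPolynomial.X i - alphaOp n =
    alphaOp n * (∏ i : Fin n, MvPolynomial.X i - 1) by ring]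
  exact Ideal.mul_mem_left _ _ (prod_X_sub_one_mem_chooseDetAnn n)

theorem alpha_add_natCast (n t : ℕ) (k : Fin n → ℤ) : alpha n (fun i => k i + t) = alpha n k := by
  induction t with
  | zero => simp
  | succ t ih =>
    rw [← ih, ← alpha_add_one n fun i => k i + t]
    congr 1
    funext i
    simp [add_assoc]

/-- Modulo `I` the element `w` is nilpotent, so `1 + w` is a unit with the finite geometric series
as inverse. -/
theorem mem_of_one_add_mul_mem {R : Type*} [CommRing R] (I : Ideal R) (w h : R) (m : ℕ)
    (hw : w ^ m ∈ I) (hh : (1 + w) * h ∈ I) : h ∈ I := by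
  have h1 : (1 + w) * ∑ i ∈ Finset.range m, (-w) ^ i = 1 - (-w) ^ m := by
    rw [← mul_neg_geom_sum]
    ring
  have h2 : h = (∑ i ∈ Finset.range m, (-w) ^ i) * ((1 + w) * h) + (-1) ^ m * h * w ^ m := by
    rw [mul_left_comm, ← mul_assoc, h1, neg_pow]
    ring
  rw [h2]
  exact Ideal.add_mem _ (Ideal.mul_mem_left _ _ hh) (Ideal.mul_mem_left _ _ hw)

/-- Modulo the annihilator of `chooseDet`, moving the first variable to the last place costs a
shift by the number of variables. -/
theorem prod_alphaFactor_sub_mem_chooseDetAnn (m : ℕ) :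
    ∏ p : Fin m, alphaFactor p.succ 0 -
      MvPolynomial.X 0 ^ (m + 1) * ∏ p : Fin m, alphaFactor 0 p.succ ∈ chooseDetAnn (m + 1) := by
  set x : MvPolynomial (Fin (m + 1)) ℤ := MvPolynomial.X 0 with hx
  refine mem_of_one_add_mul_mem _ (x * (x - 1)) _ (m + 1) ?_ ?_
  · rw [mul_pow]
    exact Ideal.mul_mem_left _ _ (sub_one_pow_mem_chooseDetAnn 0)
  -- Both products run over all variables, including the first. Their factors at index `0`, namely
  -- `x + (x - 1)^2` and `1 + x(x - 1)`, coincide; this common factor is the unit `1 + w` to be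
  -- cancelled.
  · have h1 := prod_sub_pow_mem_chooseDetAnn x (x - 1)
    have h2 := Ideal.mul_mem_left _ (x ^ (m + 1))
      (prod_sub_pow_mem_chooseDetAnn (1 : MvPolynomial (Fin (m + 1)) ℤ) x)
    rw [Fin.prod_univ_succ, ← hx] at h1 h2
    have e1 : ∀ p : Fin m, x + (x - 1) * (MvPolynomial.X p.succ - 1) = alphaFactor p.succ 0 := by
      intro p; rw [alphaFactor, ← hx]; ring
    have e2 : ∀ p : Fin m, 1 + x * (MvPolynomial.X p.succ - 1) = alphaFactor 0 p.succ := by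
      intro p; rw [alphaFactor, ← hx]; ring
    simp only [e1, e2] at h1 h2
    convert Ideal.sub_mem _ h1 h2 using 1
    ring

theorem chooseDet_comp_perm {n : ℕ} (e : Equiv.Perm (Fin n)) (k : Fin n → ℤ) :
    chooseDet n (k ∘ e) = Equiv.Perm.sign e * chooseDet n k := by
  exact Matrix.det_permute e (Matrix.of fun i j : Fin n => Ring.choose (k i) (j : ℕ))

theorem finRotate_castSucc_eq_succ {m : ℕ} (i : Fin m) : finRotate (m + 1) i.castSucc = i.succ := by
  rw [finRotate_apply, Fin.coeSucc_eq_succ]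

/-- Rotation keeps the order of all pairs except those with the last index, which becomes `0`.
Compared with `alphaOp_succ`, only the factors containing variable `0` differ, with their arguments
swapped. -/
theorem rename_finRotate_alphaOp (m : ℕ) :
    MvPolynomial.rename (finRotate (m + 1)) (alphaOp (m + 1)) =
      (∏ p : Fin m, ∏ q : Fin m, if p < q then alphaFactor p.succ q.succ else 1) *
        ∏ p : Fin m, alphaFactor p.succ 0 := by
  have h : ∀ p q : Fin (m + 1), MvPolynomial.rename (finRotate (m + 1))
      (if p < q then alphaFactor p q else 1) =
      if p < q then alphaFactor (finRotate _ p) (finRotate _ q) else 1 := by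
    intro p q
    split_ifs
    · simp [alphaFactor]
    · simp
  rw [alphaOp_eq]
  simp only [map_prod, h]
  rw [Fin.prod_univ_castSucc]
  simp only [Fin.prod_univ_castSucc (n := m), finRotate_castSucc_eq_succ, finRotate_last,
    Fin.castSucc_lt_castSucc_iff, Fin.castSucc_lt_last, if_true]
  rw [Finset.prod_mul_distrib]
  have h2 : ∀ p : Fin m, ¬ Fin.last m < p.castSucc := fun p => (Fin.le_last _).not_gt
  simp [h2]

theorem alphaOp_succ (m : ℕ) :
    alphaOp (m + 1) = (∏ p : Fin m, ∏ q : Fin m, if p < q then alphaFactor p.succ q.succ else 1) *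
      ∏ p : Fin m, alphaFactor 0 p.succ := by
  rw [alphaOp_eq, Fin.prod_univ_succ]
  simp [Fin.prod_univ_succ (n := m), mul_comm]

/-- Rotating the arguments of `α`. -/
theorem alpha_comp_finRotate (m : ℕ) (k : Fin (m + 1) → ℤ) :
    alpha (m + 1) (k ∘ finRotate (m + 1)) =
      (-1) ^ m * alpha (m + 1) (k + Pi.single 0 ((m + 1 : ℕ) : ℤ)) := by
  have h1 := shiftHom_comp (fun k : Fin (m + 1) → ℤ => k ∘ finRotate (m + 1))
    (finRotate (m + 1)).symm (by
      intro k p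
      funext i
      simp only [Function.comp_apply, Pi.add_apply, Pi.single_apply, Equiv.eq_symm_apply])
    (MvPolynomial.rename (finRotate (m + 1)) (alphaOp (m + 1))) (chooseDet (m + 1)) k
  have h2 : MvPolynomial.rename (finRotate (m + 1)).symm
      (MvPolynomial.rename (finRotate (m + 1)) (alphaOp (m + 1))) = alphaOp (m + 1) := by
    rw [MvPolynomial.rename_rename]
    simp
  have h3 : chooseDet (m + 1) ∘ (fun k : Fin (m + 1) → ℤ => k ∘ finRotate (m + 1)) =
      ((-1) ^ m : ℤ) • chooseDet (m + 1) := by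
    funext k
    rw [Function.comp_apply, chooseDet_comp_perm, sign_finRotate]
    simp
  have h4 : shiftHom (m + 1) (MvPolynomial.rename (finRotate (m + 1)) (alphaOp (m + 1)))
      (chooseDet (m + 1)) =
      shiftHom (m + 1) (MvPolynomial.X 0 ^ (m + 1) * alphaOp (m + 1)) (chooseDet (m + 1)) := by
    refine shiftHom_eq_of_sub_mem ?_
    rw [rename_finRotate_alphaOp, alphaOp_succ, mul_left_comm, ← mul_sub]
    exact Ideal.mul_mem_left _ _ (prod_alphaFactor_sub_mem_chooseDetAnn m)
  rw [h2, h3, map_smul, h4, Pi.smul_apply, smul_eq_mul, map_mul, Module.End.mul_apply,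
    shiftHom_X_pow] at h1
  exact h1.symm

/-! ### The reflection symmetry of `α`. -/

theorem prod_factorial_mul_chooseDet {n : ℕ} (k : Fin n → ℤ) :
    (∏ i : Fin n, ((i : ℕ).factorial : ℤ)) * chooseDet n k = (Matrix.vandermonde k).det := by
  rw [Matrix.det_eval_matrixOfPolynomials_eq_det_vandermonde k (fun i => descPochhammer ℤ i)
    (fun i => descPochhammer_natDegree ℤ i) (fun i => monic_descPochhammer ℤ i), chooseDet,
    ← Matrix.det_mul_row]
  congr 1
  ext i j
  have h := Ring.descPochhammer_eq_factorial_smul_choose (k i) j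
  rw [← Polynomial.eval_eq_smeval] at h
  simp [h]

theorem vandermonde_det_neg_rev {n : ℕ} (k : Fin n → ℤ) :
    (Matrix.vandermonde fun i => -k (Fin.rev i)).det = (Matrix.vandermonde k).det := by
  rw [Matrix.det_vandermonde, Matrix.det_vandermonde]
  rw [Finset.prod_comm' (s := Finset.univ) (t := fun i : Fin n => Finset.Ioi i)
    (t' := Finset.univ) (s' := fun j : Fin n => Finset.Iio j) (by simp)]
  refine Fintype.prod_equiv Fin.revPerm _ _ fun i => ?_
  refine Finset.prod_nbij' Fin.rev Fin.rev ?_ ?_ ?_ ?_ ?_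
  · intro j hj; simpa using hj
  · intro j hj; simpa [Fin.rev_lt_iff] using hj
  · simp
  · simp
  · intro j _; simp; ring

/-- Up to the nonzero product of factorials this is the Vandermonde determinant, and negating while
reversing permutes the differences `k_q - k_p` with `p < q`. -/
theorem chooseDet_neg_rev {n : ℕ} (k : Fin n → ℤ) :
    chooseDet n (fun i => -k (Fin.rev i)) = chooseDet n k := by
  have h : (∏ i : Fin n, ((i : ℕ).factorial : ℤ)) ≠ 0 :=
    Finset.prod_ne_zero_iff.2 fun i _ => by exact_mod_cast Nat.factorial_ne_zero _
  apply mul_left_cancel₀ h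
  rw [prod_factorial_mul_chooseDet, prod_factorial_mul_chooseDet, vandermonde_det_neg_rev]

/-- Under `k ↦ -k` reversed, each shift becomes the inverse of the shift in the mirrored variable.
The extra monomial clears these inverses, since `E_p E_q (1 + E_p⁻¹ E_q⁻¹ - E_p⁻¹) = 1 + E_q E_p -
E_q`. -/
theorem shiftHom_alphaFactor_neg_rev {n : ℕ} (p q : Fin n) (f : (Fin n → ℤ) → ℤ) :
    shiftHom n (alphaFactor p q) (shiftHom n (MvPolynomial.X p.rev * MvPolynomial.X q.rev) f ∘
      fun k i => -k (Fin.rev i)) =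
      shiftHom n (alphaFactor q.rev p.rev) f ∘ fun k i => -k (Fin.rev i) := by
  have hg : ∀ (k : Fin n → ℤ) (r : Fin n), (fun i => -(k + Pi.single r 1 : Fin n → ℤ) (Fin.rev i)) =
      (fun i => -k (Fin.rev i)) - Pi.single r.rev 1 := by
    intro k r
    funext i
    simp only [Pi.add_apply, Pi.sub_apply, Pi.single_apply, Fin.rev_eq_iff]
    ring
  funext k
  simp only [alphaFactor, map_sub, map_add, map_mul, map_one, LinearMap.sub_apply,
    LinearMap.add_apply, Pi.sub_apply, Pi.add_apply (M := fun _ : Fin n → ℤ => ℤ), shiftHom_X,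
    Module.End.one_apply, Module.End.mul_apply, Function.comp_apply, hg]
  generalize (fun i => -k (Fin.rev i)) = l
  generalize (Pi.single p.rev 1 : Fin n → ℤ) = u
  generalize (Pi.single q.rev 1 : Fin n → ℤ) = v
  rw [show l - u - v + u + v = l by abel, show l - u + u + v = l + v by abel,
    show l + u + v = l + v + u by abel]
  ring

theorem shiftHom_prod_alphaFactor_neg_rev {n : ℕ} (S : Finset (Fin n × Fin n))
    (f : (Fin n → ℤ) → ℤ) :
    shiftHom n (∏ x ∈ S, alphaFactor x.1 x.2)
      (shiftHom n (∏ x ∈ S, MvPolynomial.X x.1.rev * MvPolynomial.X x.2.rev) f ∘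
        fun k i => -k (Fin.rev i)) =
      shiftHom n (∏ x ∈ S, alphaFactor x.2.rev x.1.rev) f ∘ fun k i => -k (Fin.rev i) := by
  induction S using Finset.induction_on generalizing f with
  | empty => simp
  | insert a S ha ih =>
    simp only [Finset.prod_insert ha]
    rw [mul_comm (alphaFactor a.1 a.2), map_mul, Module.End.mul_apply, map_mul (shiftHom n)
      (MvPolynomial.X a.1.rev * MvPolynomial.X a.2.rev), Module.End.mul_apply,
      shiftHom_alphaFactor_neg_rev, ← Module.End.mul_apply, ← map_mul, mul_comm (alphaFactor _ _),
      map_mul, Module.End.mul_apply, ih, mul_comm (alphaFactor _ _), map_mul, Module.End.mul_apply]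

theorem prod_lt_eq {n : ℕ} {R : Type*} [CommMonoid R] (F : Fin n → Fin n → R) :
    ∏ x ∈ Finset.univ.filter (fun x : Fin n × Fin n => x.1 < x.2), F x.1 x.2 =
      ∏ p : Fin n, ∏ q ∈ Finset.Ioi p, F p q := by
  rw [Finset.prod_filter, ← Finset.univ_product_univ, Finset.prod_product]
  refine Finset.prod_congr rfl fun p _ => ?_
  rw [← Finset.prod_filter]
  refine Finset.prod_congr ?_ fun _ _ => rfl
  ext q; simp

theorem prod_lt_rev_eq {n : ℕ} {R : Type*} [CommMonoid R] (F : Fin n → Fin n → R) :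
    ∏ x ∈ Finset.univ.filter (fun x : Fin n × Fin n => x.1 < x.2), F x.2.rev x.1.rev =
      ∏ p : Fin n, ∏ q ∈ Finset.Ioi p, F p q := by
  rw [← prod_lt_eq]
  refine Finset.prod_nbij' (fun x => (x.2.rev, x.1.rev)) (fun x => (x.2.rev, x.1.rev))
    ?_ ?_ ?_ ?_ ?_ <;> simp

theorem prod_lt_mul_eq_pow {n : ℕ} {R : Type*} [CommMonoid R] (v : Fin n → R) :
    ∏ p : Fin n, ∏ q ∈ Finset.Ioi p, v p * v q = (∏ p : Fin n, v p) ^ (n - 1) := by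
  simp only [Finset.prod_mul_distrib]
  rw [Finset.prod_comm' (s := Finset.univ) (t := fun i : Fin n => Finset.Ioi i)
    (t' := Finset.univ) (s' := fun j : Fin n => Finset.Iio j) (f := fun _ q => v q) (by simp),
    ← Finset.prod_mul_distrib, ← Finset.prod_pow]
  refine Finset.prod_congr rfl fun p _ => ?_
  rw [Finset.prod_const, Finset.prod_const, Fin.card_Ioi, Fin.card_Iio, ← pow_add]
  congr 1
  omega

/-- The reflection symmetry `α(n; -k_n, …, -k_1) = α(n; k_1, …, k_n)`. -/
theorem alpha_neg_rev (n : ℕ) (k : Fin n → ℤ) : alpha n (fun i => -k (Fin.rev i)) = alpha n k := by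
  have h1 := shiftHom_prod_alphaFactor_neg_rev
    (Finset.univ.filter fun x : Fin n × Fin n => x.1 < x.2) (chooseDet n)
  have h3 : ∏ x ∈ Finset.univ.filter (fun x : Fin n × Fin n => x.1 < x.2),
      (MvPolynomial.X x.1.rev * MvPolynomial.X x.2.rev : MvPolynomial (Fin n) ℤ) =
      (∏ p : Fin n, MvPolynomial.X p) ^ (n - 1) := by
    rw [← prod_lt_mul_eq_pow, ← prod_lt_rev_eq fun p q : Fin n =>
      (MvPolynomial.X p * MvPolynomial.X q : MvPolynomial (Fin n) ℤ)]
    exact Finset.prod_congr rfl fun _ _ => mul_comm _ _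
  -- Each index lies in `n - 1` pairs, so the accumulated monomial is a power of the total shift,
  -- which fixes the determinant.
  have h4 : shiftHom n ((∏ p : Fin n, MvPolynomial.X p) ^ (n - 1)) (chooseDet n) =
      chooseDet n := by
    have := shiftHom_eq_of_sub_mem (n := n) (P := (∏ p : Fin n, MvPolynomial.X p) ^ (n - 1))
      (Q := 1) (Ideal.mem_of_dvd _ (sub_one_dvd_pow_sub_one _ _) (prod_X_sub_one_mem_chooseDetAnn n))
    simpa using this
  rw [prod_lt_eq alphaFactor, prod_lt_rev_eq alphaFactor, h3, h4] at h1
  have h5 : chooseDet n ∘ (fun (k : Fin n → ℤ) i => -k (Fin.rev i)) = chooseDet n := by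
    funext k
    exact chooseDet_neg_rev k
  rw [h5] at h1
  exact (congrFun h1 k).symm

/-! ### The function `k₁ ↦ α(n; k₁, 2d, …, nd)`. -/

theorem fwdDiff_iterate_update (n : ℕ) (p : Fin n) (f : (Fin n → ℤ) → ℤ) (r : Fin n → ℤ) (j : ℕ) :
    (Δ_[(1 : ℤ)])^[j] (fun t : ℤ => f (r + Pi.single p t)) =
      fun t => shiftHom n ((MvPolynomial.X p - 1) ^ j) f (r + Pi.single p t) := by
  induction j with
  | zero => simp
  | succ j ih =>
    rw [Function.iterate_succ_apply', ih]
    funext t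
    rw [pow_succ', map_mul, Module.End.mul_apply, fwdDiff, map_sub, map_one, LinearMap.sub_apply,
      Pi.sub_apply, shiftHom_X, Module.End.one_apply, add_assoc, ← Pi.single_add]

theorem alphaRow_eq (m d : ℕ) (t : ℤ) :
    alphaRow (m + 1) d t =
      alpha (m + 1) ((fun j : Fin (m + 1) => if (j : ℕ) = 0 then 0 else ((j : ℤ) + 1) * d) +
        Pi.single 0 t) := by
  rw [alphaRow]
  congr 1
  funext j
  refine Fin.cases ?_ (fun j => ?_) j <;> simp

theorem fwdDiff_iterate_alphaRow (m d : ℕ) : (Δ_[(1 : ℤ)])^[m + 1] (alphaRow (m + 1) d) = 0 := by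
  rw [funext (alphaRow_eq m d), fwdDiff_iterate_update]
  funext t
  rw [alpha_eq, ← Module.End.mul_apply, ← map_mul, mul_comm]
  have h := mem_chooseDetAnn.1
    (Ideal.mul_mem_left _ (alphaOp (m + 1)) (sub_one_pow_mem_chooseDetAnn (n := m + 1) 0))
  rw [h]
  rfl

/-- Negation and reversal followed by translation by `(n+2)d` maps the fixed arguments `2d, …, nd`
onto themselves and sends the free argument to the last place; rotation brings it back to the front.
-/
theorem alphaRow_reflect (m d : ℕ) (t : ℤ) :
    alphaRow (m + 1) d t =
      (-1) ^ m * alphaRow (m + 1) d (((m : ℤ) + 3) * d + (m + 1) - t) := by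
  -- The first entry is lowered by `n = m + 1` so that the shift in the rotation rule restores it to
  -- `t`.
  set r : Fin (m + 1) → ℤ := fun j => if (j : ℕ) = 0 then t - (m + 1) else ((j : ℤ) + 1) * d with hr
  have h1 := alpha_comp_finRotate m r
  have h2 : alphaRow (m + 1) d t = alpha (m + 1) (r + Pi.single 0 ((m + 1 : ℕ) : ℤ)) := by
    rw [alphaRow]
    congr 1
    funext j
    refine Fin.cases ?_ (fun j => ?_) j <;> simp [hr]
  have h3 : alphaRow (m + 1) d (((m : ℤ) + 3) * d + (m + 1) - t) =
      alpha (m + 1) (r ∘ finRotate (m + 1)) := by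
    rw [← alpha_neg_rev, ← alpha_add_natCast _ ((m + 3) * d), alphaRow]
    congr 1
    funext j
    refine Fin.cases ?_ (fun j => ?_) j
    · simp [hr]
      ring
    · rw [Fin.rev_succ, Function.comp_apply, finRotate_castSucc_eq_succ]
      simp [hr]
      ring
  rw [h2, h3, h1, ← mul_assoc, ← mul_pow]
  simp

/-! ### Extended sums and iterated inverse differences. -/

theorem extSum_add_one (a b : ℤ) (f : ℤ → ℤ) : extSum (a + 1) b f = extSum a b f - f a := by
  unfold extSum
  rcases lt_trichotomy a b with h | h | h
  · rw [if_pos (by omega), if_pos h.le, ← Finset.insert_Icc_add_one_left_eq_Icc h.le,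
      Finset.sum_insert (by simp)]
    ring
  · subst h
    simp
  · rw [if_neg (by omega), if_neg (by omega), add_sub_cancel_right,
      ← Finset.insert_Icc_sub_one_right_eq_Icc (show b + 1 ≤ a by omega),
      Finset.sum_insert (by simp)]
    ring

/-- Reflection swaps the limits. The sign convention for reversed sums swaps them back, keeping the
limit that depends on `a` in the lower place, as `invDelta` requires. -/
theorem extSum_comp_sub (a b c : ℤ) (f : ℤ → ℤ) :
    extSum a b (fun y => f (c - y)) = -extSum (c - a + 1) (c - b - 1) f := by
  have h : ∀ u v : ℤ, ∑ y ∈ Finset.Icc u v, f (c - y) = ∑ y ∈ Finset.Icc (c - v) (c - u), f y := by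
    intro u v
    refine Finset.sum_nbij' (fun y => c - y) (fun y => c - y) ?_ ?_ ?_ ?_ ?_ <;>
      intro y hy <;> simp at * <;> omega
  unfold extSum
  split_ifs with h1 h2 h2
  · omega
  · rw [h, neg_neg]
    congr 2 <;> ring
  · rw [h]
    congr 3 <;> ring
  · have h3 : b = a - 1 := by omega
    subst h3
    simp

theorem fwdDiff_invDelta (z : ℤ) (p : ℤ → ℤ) : Δ_[(1 : ℤ)] (invDelta z p) = p := by
  funext k
  simp only [fwdDiff, invDelta, extSum_add_one]
  ring

theorem deltaPow_neg_succ (z : ℤ → ℤ) (m : ℕ) (p : ℤ → ℤ) :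
    deltaPow z (-((m : ℤ) + 1)) p = invDelta (z (-((m : ℤ) + 1))) (deltaPow z (-(m : ℤ)) p) := by
  unfold deltaPow
  rw [if_neg (by omega)]
  have h1 : (-(-((m : ℤ) + 1))).toNat = m + 1 := by omega
  rw [h1, invDeltaPow]
  split_ifs with h
  · have : m = 0 := by omega
    subst this
    simp [invDeltaPow]
  · have h2 : (-(-(m : ℤ))).toNat = m := by omega
    rw [h2]

/-- For negative `i` the difference cancels the outermost inverse difference whatever its bound, so
negative and nonnegative orders form a single chain under `Δ`. -/
theorem fwdDiff_deltaPow (z : ℤ → ℤ) (i : ℤ) (p : ℤ → ℤ) :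
    Δ_[(1 : ℤ)] (deltaPow z i p) = deltaPow z (i + 1) p := by
  rcases le_or_gt 0 i with h | h
  · lift i to ℕ using h
    rw [deltaPow, if_pos (by omega), deltaPow, if_pos (by omega)]
    exact (Function.iterate_succ_apply' _ _ _).symm
  · obtain ⟨m, rfl⟩ : ∃ m : ℕ, i = -((m : ℤ) + 1) := ⟨(-i - 1).toNat, by omega⟩
    rw [deltaPow_neg_succ, fwdDiff_invDelta]
    congr 1
    ring

theorem fwdDiff_iterate_deltaPow (z : ℤ → ℤ) (i : ℤ) (p : ℤ → ℤ) (l : ℕ) :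
    (Δ_[(1 : ℤ)])^[l] (deltaPow z i p) = deltaPow z (i + l) p := by
  induction l with
  | zero => simp
  | succ l ih =>
    rw [Function.iterate_succ_apply', ih, fwdDiff_deltaPow]
    push_cast
    rw [add_assoc]

/-- A symmetry `p (k) = ε p (S - k)` carries over to the (inverse) differences of `p`. -/
theorem deltaPow_reflect (p : ℤ → ℤ) (ε S : ℤ) (hp : ∀ k, p k = ε * p (S - k)) (x : ℤ → ℤ)
    (i : ℤ) (k : ℤ) :
    deltaPow x i p k =
      ε * i.negOnePow * deltaPow (fun j => S - x j - j - 2) i p (S - k - i) := by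
  rcases le_or_gt 0 i with h | h
  · lift i to ℕ using h
    simp only [deltaPow, if_pos (Int.natCast_nonneg i), Int.toNat_natCast]
    induction i generalizing k with
    | zero => simpa using hp k
    | succ i ih =>
      rw [Function.iterate_succ_apply']
      simp only [fwdDiff]
      rw [ih (k + 1), ih k]
      push_cast
      rw [Int.negOnePow_succ, show S - (k + 1) - (i : ℤ) = S - k - (i + 1) by ring,
        show S - k - (i : ℤ) = S - k - (i + 1) + 1 by ring]
      push_cast
      ring
  · obtain ⟨m, rfl⟩ : ∃ m : ℕ, i = -(m : ℤ) := ⟨(-i).toNat, by omega⟩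
    clear h
    induction m generalizing k with
    | zero => simpa [deltaPow] using hp k
    | succ m ih =>
      push_cast
      rw [deltaPow_neg_succ, deltaPow_neg_succ, invDelta, invDelta, funext ih]
      have hs : ∀ (a b c : ℤ) (f : ℤ → ℤ),
          extSum a b (fun y => c * f y) = c * extSum a b f := by
        intro a b c f
        unfold extSum
        split_ifs <;> simp [Finset.mul_sum]
      simp only [sub_right_comm S _ (-(m : ℤ))]
      -- The inner reflection is about `S + m`. For order `j = -m - 1` the upper limit `x_j` becomes
      -- `S + m - x_j - 1 = S - x_j - j - 2`, and reversing the sum contributes the new sign.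
      rw [hs, extSum_comp_sub, show -((m : ℤ) + 1) = -(m : ℤ) - 1 by ring, Int.negOnePow_sub,
        Int.negOnePow_one]
      push_cast
      rw [show S - -(m : ℤ) - k + 1 = S - k - (-(m : ℤ) - 1) by ring,
        show S - -(m : ℤ) - x (-(m : ℤ) - 1) - 1 = S - x (-(m : ℤ) - 1) - (-(m : ℤ) - 1) - 2 by ring]
      ring

theorem deltaPow_eq_zero (z : ℤ → ℤ) (p : ℤ → ℤ) (n : ℕ) (hp : (Δ_[(1 : ℤ)])^[n] p = 0) (i : ℤ)
    (hi : n ≤ i) : deltaPow z i p = 0 := by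
  obtain ⟨l, rfl⟩ : ∃ l : ℕ, i = n + l := ⟨(i - n).toNat, by omega⟩
  rw [← fwdDiff_iterate_deltaPow]
  have h : deltaPow z n p = 0 := by
    rw [deltaPow, if_pos (by omega), Int.toNat_natCast, hp]
  rw [h]
  exact Function.iterate_fixed (by funext; simp [fwdDiff]) l

/-- Newton's expansion of a shift in powers of `Δ`. The bound `hm` ensures that it reaches order `n
- 1`; all later terms vanish because `Δ^n p = 0`. -/
theorem deltaPow_add_natCast (z : ℤ → ℤ) (p : ℤ → ℤ) (n : ℕ) (hp : (Δ_[(1 : ℤ)])^[n] p = 0)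
    (i a : ℤ) (m : ℕ) (hi : i ≤ n) (hm : (n : ℤ) - 1 - i ≤ m) :
    deltaPow z i p (a + m) =
      ∑ j ∈ Finset.Icc i ((n : ℤ) - 1), binom m (j - i) * deltaPow z j p a := by
  have h := shift_eq_sum_fwdDiff_iter (1 : ℤ) (deltaPow z i p) m a
  rw [nsmul_one] at h
  rw [h]
  simp only [fwdDiff_iterate_deltaPow]
  have hL : Finset.range ((n : ℤ) - i).toNat ⊆ Finset.range (m + 1) := by
    intro l hl
    simp only [Finset.mem_range] at *
    omega
  rw [← Finset.sum_subset hL]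
  · refine Finset.sum_nbij' (fun l => i + (l : ℤ)) (fun j => (j - i).toNat) ?_ ?_ ?_ ?_ ?_
    · intro l hl; simp at *; omega
    · intro l hl; simp at *; omega
    · intro l hl; simp
    · intro l hl; simp at *; omega
    · intro l hl
      simp [binom, Ring.choose_natCast]
  · intro l _ hl
    rw [deltaPow_eq_zero z p n hp _ (by simp at hl; omega)]
    simp

/-! ### The linear relation between the two families. -/

theorem proposition5p2 (n d : ℕ) (hn : 1 ≤ n) (hd : 1 ≤ d) (x : ℤ → ℤ) (i : ℤ)
    (hi₁ : -(n : ℤ) ≤ i) (hi₂ : i ≤ (n : ℤ) - 1) :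
    numC n d x i =
      ∑ j ∈ Finset.Icc i ((n : ℤ) - 1),
        binom ((n : ℤ) * (d + 1) - i - 2) (j - i) * ((j + n + 1).negOnePow : ℤ) * numD n d x j := by
  obtain ⟨m, rfl⟩ : ∃ m, n = m + 1 := ⟨n - 1, by omega⟩
  -- Here `d ≥ 1` enters: it makes `N = n(d+1) - i - 2` nonnegative and at least `n - 1 - i`, so the
  -- Newton expansion applies in full.
  have hmd : (m : ℤ) + 1 ≤ (m + 1) * d := by
    have : (1 : ℤ) ≤ d := by exact_mod_cast hd
    nlinarith
  obtain ⟨N, hN⟩ : ∃ N : ℕ, ((m + 1 : ℕ) : ℤ) * (d + 1) - i - 2 = N := by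
    refine ⟨(((m + 1 : ℕ) : ℤ) * (d + 1) - i - 2).toNat, (Int.toNat_of_nonneg ?_).symm⟩
    push_cast at *
    linarith
  have hz : zSeq (m + 1) d x =
      fun j => (((m : ℤ) + 3) * d + (m + 1)) - x j - j - 2 := by
    funext j
    rw [zSeq]
    push_cast
    ring
  have h1 := deltaPow_reflect _ _ _ (alphaRow_reflect m d) x i ((d : ℤ) + 1)
  rw [← hz, show ((m : ℤ) + 3) * d + (m + 1) - (d + 1) - i = (d + 1) + N by
    rw [← hN]; push_cast; ring, deltaPow_add_natCast _ _ (m + 1)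
      (fwdDiff_iterate_alphaRow m d) _ _ N (by omega) (by push_cast at *; linarith)] at h1
  have hs : ∀ a : ℤ, ((a.negOnePow : ℤˣ) : ℤ) * a.negOnePow = 1 := by
    intro a
    rw [← Units.val_mul, Int.units_mul_self, Units.val_one]
  rw [numC, h1, hN, ← mul_assoc, mul_left_comm, hs, mul_one, Finset.mul_sum]
  refine Finset.sum_congr rfl fun j _ => ?_
  -- The sign `(-1)^j` here cancels the one inside `numD`, leaving the `(-1)^(n-1)` of the
  -- reflection symmetry.
  have hj : ((j + (m + 1 : ℕ) + 1).negOnePow : ℤ) = j.negOnePow * (-1) ^ m := by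
    rw [show j + ((m + 1 : ℕ) : ℤ) + 1 = j + m + 2 by push_cast; ring,
      Int.negOnePow_add _ 2, Int.negOnePow_add, Int.negOnePow_even 2 (by decide), mul_one]
    simp [Int.negOnePow]
  rw [numD, hj]
  linear_combination (-(-1) ^ m * binom N (j - i) *
    deltaPow (zSeq (m + 1) d x) j (alphaRow (m + 1) d) (d + 1)) * hs j
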